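/- Let $\kappa$ be a regular cardinal and let $(\mathcal K,U)$ be a weak $\kappa$-CAEC: $\mathcal K$ is an accessible category with directed colimits all of whose morphisms are monomorphisms, and $U:\mathcal K\to\mathbf{Set}$ is a faithful functor that preserves monomorphisms and $\kappa$-directed colimits and is coherent (whenever $h:A\to C$ and $g:B\to C$ are morphisms of $\mathcal K$ and $f:UA\to UB$ is a map with $U(g)f=U(h)$, there is $f':A\to B$ in $\mathcal K$ with $U(f')=f$). Assume that $\mathcal K$ has the amalgamation property. Let $\mathcal K$ be $\lambda$-accessible, $\lambda$ regular, and let $\lambda_U\ge\lambda$ be the least regular cardinal $\theta\geq\lambda$ such that $U$ takes $\theta$-presentable objects to $\theta$-presentable objects (i.e. to sets of cardinality less than $\theta$). An object has size $\mu$ if the least regular cardinal $\theta$ for which it is $\theta$-presentable is $\mu^+$; it has size at most $\mu$ if it is $\mu^+$-presentable. Two pairs $(f_0,a_0)$, $(f_1,a_1)$ with $f_i:M\to N_i$ and $a_i\in U(N_i)$ represent the same Galois type over $M$ if there are $h_i:N_i\to P$ with $h_0f_0=h_1f_1$ and $U(h_0)(a_0)=U(h_1)(a_1)$. Given $g:M\to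 M'$, the object $M'$ realizes all types over $M$ if every pair $(f,a)$ over $M$ represents the same type as $(g,b)$ for some $b\in U(M')$. A morphism $m:M\to\bar M$ is a $1$-special extension, where $M$ and $\bar M$ are of size $\mu$, if there is a continuous chain $M=M_0\to M_1\to\dots\to M_i\to\dots$ $(i<\mu)$ with colimit $\bar M$ and $m$ the colimit map from $M_0$, such that $M_{i+1}$ realizes all types over $M_i$ (via $M_i\to M_{i+1}$) for all $i<\mu$. Let $\mu$ be an infinite cardinal such that $\kappa$ is sharply smaller than $\mu^+$ ($\mu^+\rhd\kappa$) and $\mu\ge\lambda_U$, and let $m:M\to\bar M$ be a $1$-special extension with $M$ and $\bar M$ of size $\mu$. Then $\bar M$ is universal over $M$: for every $h:M\to N$ with $N$ of size at most $\mu$ there is $t:N\to\bar M$ such that $th=m$. -/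

import Mathlib

universe w v u

open CategoryTheory CategoryTheory.Limits

namespace WeakCAEC

section

variable {K : Type u} [Category.{v} K] (U : K ⥤ Type w)

/-- The pair `(K, U)` is coherent: a map of underlying sets `f : UA → UB` with `U(g) ∘ f = U(h)`
for some morphisms `h : A ⟶ C` and `g : B ⟶ C` underlies a morphism `A ⟶ B`. -/
def IsCoherent : Prop :=
  ∀ ⦃A B C : K⦄ (h : A ⟶ C) (g : B ⟶ C) (f : U.obj A ⟶ U.obj B),
    f ≫ U.map g = U.map h → ∃ f' : A ⟶ B, U.map f' = f

/-- `(K, U)` is a weak `κ`-concrete abstract elementary class (`κ` a regular cardinal). -/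
structure IsWeakCAEC (κ : Cardinal.{w}) [Fact κ.IsRegular] : Prop where
  faithful : U.Faithful
  accessible : IsAccessibleCategory.{w} K
  hasDirectedColimits : HasFilteredColimitsOfSize.{w, w} K
  mono : ∀ ⦃A B : K⦄ (f : A ⟶ B), Mono f
  coherent : IsCoherent U
  concreteMonos : U.PreservesMonomorphisms
  preservesDirectedColimits : U.IsCardinalAccessible κ

variable (K) in
/-- The amalgamation property. -/
def HasAmalgamation : Prop :=
  ∀ ⦃M N₀ N₁ : K⦄ (f₀ : M ⟶ N₀) (f₁ : M ⟶ N₁),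
    ∃ (P : K) (h₀ : N₀ ⟶ P) (h₁ : N₁ ⟶ P), f₀ ≫ h₀ = f₁ ≫ h₁

/-- The pairs `(f₀, a₀)` and `(f₁, a₁)`, with `fᵢ : M ⟶ Nᵢ` and `aᵢ ∈ U(Nᵢ)`, represent the same
Galois (1-)type over `M`. -/
def SameType {M N₀ N₁ : K} (f₀ : M ⟶ N₀) (a₀ : U.obj N₀) (f₁ : M ⟶ N₁) (a₁ : U.obj N₁) : Prop :=
  ∃ (P : K) (h₀ : N₀ ⟶ P) (h₁ : N₁ ⟶ P),
    f₀ ≫ h₀ = f₁ ≫ h₁ ∧ U.map h₀ a₀ = U.map h₁ a₁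

/-- The property of a morphism `g : M ⟶ M'` that `M'` realizes, via `g`, all types over `M`. -/
def realizesAllTypes : MorphismProperty K := fun M M' g ↦
  ∀ ⦃N : K⦄ (f : M ⟶ N) (a : U.obj N), ∃ b : U.obj M', SameType U f a g b

/-- `m : M ⟶ M'` exhibits `M'` as a 1-special extension of `M` (for `M`, `M'` of size `μ`):
`m` is the map from the first object to the colimit of a continuous chain
`M = M₀ ⟶ M₁ ⟶ ⋯ ⟶ Mᵢ ⟶ ⋯` (`i < μ`) such that `Mᵢ₊₁` realizes all types over `Mᵢ`.
(The order on `μ.ord.ToType` is the well-order of type `μ`; a least element exists, and is unique,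
for `μ ≠ 0`.) -/
def IsOneSpecial (μ : Cardinal.{w}) {M M' : K} (m : M ⟶ M') : Prop :=
  ∃ _ : OrderBot μ.ord.ToType,
    Nonempty ((realizesAllTypes U).TransfiniteCompositionOfShape μ.ord.ToType m)

/-- `M` is of size `μ`: its presentability rank, the least regular cardinal `θ` such that
`M` is `θ`-presentable, is `μ⁺`. -/
def HasSize (M : K) (μ : Cardinal.{w}) [Fact (Order.succ μ).IsRegular] : Prop :=
  IsCardinalPresentable M (Order.succ μ) ∧
    ∀ (θ : Cardinal.{w}) [Fact θ.IsRegular], IsCardinalPresentable M θ → Order.succ μ ≤ θ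

/-- `M` is of size at most `μ`: its presentability rank is at most `μ⁺`. -/
def HasSizeLE (M : K) (μ : Cardinal.{w}) [Fact (Order.succ μ).IsRegular] : Prop :=
  IsCardinalPresentable M (Order.succ μ)

/-- `M'` is `μ`-universal over `M` (via `m`); for `M` and `M'` of size `μ`, one says that
`M'` is universal over `M`. -/
def IsUniversalOver (μ : Cardinal.{w}) [Fact (Order.succ μ).IsRegular]
    {M M' : K} (m : M ⟶ M') : Prop :=
  ∀ ⦃N : K⦄ (h : M ⟶ N), HasSizeLE M μ → HasSizeLE N μ → ∃ t : N ⟶ M', h ≫ t = m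

/-- `U` preserves `θ`-presentable objects. -/
def PreservesPresentable (θ : Cardinal.{w}) [Fact θ.IsRegular] : Prop :=
  ∀ ⦃X : K⦄, IsCardinalPresentable X θ → IsCardinalPresentable (U.obj X) θ

/-- The cardinal `λ_U`: the least regular cardinal `θ ≥ lam` such that `U` preserves
`θ`-presentable objects. -/
noncomputable def lambdaU (lam : Cardinal.{w}) : Cardinal.{w} :=
  sInf {θ | lam ≤ θ ∧ ∃ _ : Fact θ.IsRegular, PreservesPresentable U θ}

end

end WeakCAEC

/-!
Let `M'` be the colimit of the chain `Mᵢ` (`i < μ`), let `h : M ⟶ N`, and fix an enumeration in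
length `μ` of at most `μ` elements of `N`. Amalgamating `N` with the stages of the chain one after
the other, taking colimits at limit stages, one makes sure, as `Mᵢ₊₁` realizes all types over `Mᵢ`,
that the image of `Mᵢ₊₁` in the amalgam contains the `i`-th element. The result is an amalgam `P` of
`M'` and `N` over `M` in which all the chosen elements of `N` come from `M'`.

There is no need to enumerate all of `N`: as an object of size at most `μ`, it is a retract of the
colimit of at most `μ` `lam`-presentable objects `Gᵢ`, each of which has at most `μ` elements, and
`U` does not have to preserve this colimit. If the images of the elements of all the `Gᵢ` in `P`
come from `M'`, then by coherence each `Gᵢ ⟶ P` factors through the monomorphism `M' ⟶ P`, hence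
so does `N ⟶ P`.
-/

namespace WeakCAEC

section PartialColimits

variable {K : Type u} [Category.{v} K] {I : Type*} [Preorder I] (D : I ⥤ K)

/-- The restriction of a diagram to a subset of the indexing preorder. -/
abbrev restrict (A : Set I) : A ⥤ K :=
  (Subtype.mono_coe (· ∈ A)).functor ⋙ D

/-- The morphism between the colimits of two restrictions of a diagram. -/
noncomputable def colimitRestrictMap {A B : Set I} (hAB : A ⊆ B) [HasColimit (restrict D A)]
    [HasColimit (restrict D B)] : colimit (restrict D A) ⟶ colimit (restrict D B) :=
  colimit.desc (restrict D A) ((colimit.cocone (restrict D B)).whisker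
    (Monotone.functor (f := Set.inclusion hAB) fun _ _ hij ↦ hij))

lemma ι_colimitRestrictMap {A B : Set I} (hAB : A ⊆ B) [HasColimit (restrict D A)]
    [HasColimit (restrict D B)] (i : A) :
    colimit.ι (restrict D A) i ≫ colimitRestrictMap D hAB =
      colimit.ι (restrict D B) ⟨i, hAB i.2⟩ :=
  colimit.ι_desc _ _

variable {T : Type*} [Preorder T] {S : T → Set I} (hS : Monotone S)
  [∀ t, HasColimit (restrict D (S t))]

/-- The diagram of the colimits of `D` over the members of an increasing family of subsets of
the indexing preorder. -/
noncomputable def partialColimits : T ⥤ K where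
  obj t := colimit (restrict D (S t))
  map f := colimitRestrictMap D (hS (leOfHom f))
  map_id t := colimit.hom_ext fun i ↦ by rw [ι_colimitRestrictMap, Category.comp_id]
  map_comp f g := colimit.hom_ext fun i ↦ by
    rw [ι_colimitRestrictMap, ← Category.assoc, ι_colimitRestrictMap]
    exact (ι_colimitRestrictMap D (hS (leOfHom g)) ⟨i, hS (leOfHom f) i.2⟩).symm

/-- The inclusion of a value of the diagram in a partial colimit. -/
noncomputable def partialι {t : T} {i : I} (hi : i ∈ S t) :
    D.obj i ⟶ (partialColimits D hS).obj t :=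
  colimit.ι (restrict D (S t)) ⟨i, hi⟩

lemma partialι_w {t : T} {i j : I} (f : i ⟶ j) (hi : i ∈ S t) (hj : j ∈ S t) :
    D.map f ≫ partialι D hS hj = partialι D hS hi :=
  colimit.w (restrict D (S t)) (homOfLE (leOfHom f) : (⟨i, hi⟩ : S t) ⟶ ⟨j, hj⟩)

lemma partialι_map {t t' : T} (f : t ⟶ t') {i : I} (hi : i ∈ S t) :
    partialι D hS hi ≫ (partialColimits D hS).map f = partialι D hS (hS (leOfHom f) hi) :=
  ι_colimitRestrictMap D (hS (leOfHom f)) ⟨i, hi⟩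

variable {D}

variable {hS} in
lemma partialColimits_hom_ext {t : T} {X : K} {f g : (partialColimits D hS).obj t ⟶ X}
    (hfg : ∀ (i : I) (hi : i ∈ S t), partialι D hS hi ≫ f = partialι D hS hi ≫ g) : f = g :=
  colimit.hom_ext fun i ↦ hfg i i.2

/-- The morphism from a partial colimit to the vertex of a cocone on the whole diagram. -/
noncomputable def partialDesc (c : Cocone D) (t : T) : (partialColimits D hS).obj t ⟶ c.pt :=
  colimit.desc (restrict D (S t)) (c.whisker _)

lemma partialι_desc (c : Cocone D) {t : T} {i : I} (hi : i ∈ S t) :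
    partialι D hS hi ≫ partialDesc hS c t = c.ι.app i :=
  colimit.ι_desc _ _

lemma partialι_desc_comp (c : Cocone D) {t : T} {i : I} (hi : i ∈ S t) {X : K} (f : c.pt ⟶ X) :
    partialι D hS hi ≫ partialDesc hS c t ≫ f = c.ι.app i ≫ f := by
  rw [← Category.assoc, partialι_desc]

/-- A cocone on a diagram, as a cocone on the diagram of its partial colimits. -/
noncomputable def partialCocone (c : Cocone D) : Cocone (partialColimits D hS) where
  pt := c.pt
  ι :=
    { app t := partialDesc hS c t
      naturality t t' f := partialColimits_hom_ext fun i hi ↦ by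
        rw [← Category.assoc, partialι_map, partialι_desc]
        simp [partialι_desc] }

variable [IsDirectedOrder T]

variable {hS} in
lemma partialι_comp_app_eq (s : Cocone (partialColimits D hS)) {t t' : T} {i : I}
    (hi : i ∈ S t) (hi' : i ∈ S t') :
    partialι D hS hi ≫ s.ι.app t = partialι D hS hi' ≫ s.ι.app t' := by
  obtain ⟨t'', h, h'⟩ := exists_ge_ge t t'
  rw [← s.w (homOfLE h), ← s.w (homOfLE h'), ← Category.assoc, ← Category.assoc,
    partialι_map, partialι_map]

/-- The cocone on a diagram induced by a cocone on the diagram of its partial colimits; it does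
not depend on the choice of indices `t i` with `i ∈ S (t i)`. -/
noncomputable def coconeOfPartial (s : Cocone (partialColimits D hS)) (t : I → T)
    (ht : ∀ i, i ∈ S (t i)) : Cocone D where
  pt := s.pt
  ι :=
    { app i := partialι D hS (ht i) ≫ s.ι.app (t i)
      naturality i j f := by
        obtain ⟨t', hi, hj⟩ := exists_ge_ge (t i) (t j)
        have hi' : i ∈ S t' := hS hi (ht i)
        have hj' : j ∈ S t' := hS hj (ht j)
        rw [partialι_comp_app_eq s (ht i) hi', partialι_comp_app_eq s (ht j) hj',
          ← Category.assoc, partialι_w D hS f hi' hj']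
        simp }

/-- A colimit is the colimit of its partial colimits over the members of a directed family of
subsets which covers the indexing preorder. -/
noncomputable def isColimitPartialCocone (hcover : ∀ i, ∃ t, i ∈ S t)
    {c : Cocone D} (hc : IsColimit c) : IsColimit (partialCocone hS c) :=
  let ht (i : I) := (hcover i).choose_spec
  { desc s := hc.desc (coconeOfPartial hS s _ ht)
    fac s _ := partialColimits_hom_ext fun i hi ↦
      (partialι_desc_comp hS c hi (hc.desc (coconeOfPartial hS s _ ht))).trans <|
        (hc.fac _ i).trans (partialι_comp_app_eq s _ _)
    uniq s f hf := hc.uniq (coconeOfPartial hS s _ ht) f fun i ↦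
      (partialι_desc_comp hS c (ht i) f).symm.trans (congr_arg (_ ≫ ·) (hf _)) }

end PartialColimits

section DirectedSubset

variable {I : Type w} [PartialOrder I]

lemma hasCardinalLT_set_aleph0 {X : Type w} {θ : Cardinal.{w}} (hθ : Cardinal.aleph0 < θ)
    (hX : HasCardinalLT X θ) : HasCardinalLT (HasCardinalLT.Set X Cardinal.aleph0.{w}) θ := by
  have hfinset : HasCardinalLT (Finset X) θ := by
    rw [hasCardinalLT_iff_cardinal_mk_lt] at hX ⊢
    obtain _ | _ := finite_or_infinite X
    · exact (Cardinal.lt_aleph0_of_finite _).trans hθ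
    · rwa [Cardinal.mk_finset_of_infinite]
  have hfin (A : HasCardinalLT.Set X Cardinal.aleph0.{w}) : A.1.Finite :=
    (hasCardinalLT_aleph0_iff _).1 A.2
  exact hfinset.of_injective (fun A ↦ (hfin A).toFinset) fun A B hAB ↦
    Subtype.ext (Set.Finite.toFinset_inj.1 hAB)

lemma exists_isFiltered_superset [IsFiltered I] {θ : Cardinal.{w}} [Fact θ.IsRegular]
    (hθ : Cardinal.aleph0 < θ) (A : Set I) (hA : HasCardinalLT A θ) :
    ∃ B : Set I, A ⊆ B ∧ IsFiltered B ∧ HasCardinalLT B θ := by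
  have := Cardinal.fact_isRegular_aleph0.{w}
  have := (isCardinalFiltered_aleph0_iff.{w} I).2 inferInstance
  obtain ⟨B, hAB, hB, hBθ⟩ :=
    Cardinal.SharplyLT.exists_isCardinalFiltered_set_of_exists_cofinal hθ
      (fun X hX ↦ ⟨Set.univ, (hasCardinalLT_set_aleph0 hθ hX).of_injective _
        Subtype.val_injective, fun x ↦ ⟨x, Set.mem_univ x, le_rfl⟩⟩) A hA
  exact ⟨B, hAB, (isCardinalFiltered_aleph0_iff B).1 hB, hBθ⟩

variable (I) in
/-- The poset of directed subsets of cardinality less than `θ`, ordered by inclusion. -/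
abbrev DirectedSubset (θ : Cardinal.{w}) : Type w :=
  { A : Set I // IsFiltered A ∧ HasCardinalLT A θ }

namespace DirectedSubset

lemma monotone_val {θ : Cardinal.{w}} : Monotone fun A : DirectedSubset I θ ↦ A.1 :=
  Subtype.mono_coe _

lemma isCardinalFiltered [IsFiltered I] {θ : Cardinal.{w}} [Fact θ.IsRegular]
    (hθ : Cardinal.aleph0 < θ) : IsCardinalFiltered (DirectedSubset I θ) θ :=
  isCardinalFiltered_preorder _ _ fun ι A hι ↦ by
    obtain ⟨B, hAB, hB⟩ := exists_isFiltered_superset hθ (⋃ i, (A i).1)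
      (hasCardinalLT_iUnion _ (by rwa [hasCardinalLT_iff_cardinal_mk_lt]) fun i ↦ (A i).2.2)
    exact ⟨⟨B, hB⟩, fun i ↦ (Set.subset_iUnion (fun i ↦ (A i).1) i).trans hAB⟩

lemma isFiltered [IsFiltered I] {θ : Cardinal.{w}} [Fact θ.IsRegular]
    (hθ : Cardinal.aleph0 < θ) : IsFiltered (DirectedSubset I θ) :=
  have := isCardinalFiltered (I := I) hθ
  isFiltered_of_isCardinalFiltered _ θ

lemma exists_mem [IsFiltered I] {θ : Cardinal.{w}} [Fact θ.IsRegular]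
    (hθ : Cardinal.aleph0 < θ) (i : I) : ∃ A : DirectedSubset I θ, i ∈ A.1 := by
  obtain ⟨A, hi, hA⟩ := exists_isFiltered_superset hθ {i} (hasCardinalLT_of_finite _ _ hθ.le)
  exact ⟨⟨A, hA⟩, hi rfl⟩

instance hasColimit_restrict {K : Type u} [Category.{v} K] [HasFilteredColimitsOfSize.{w, w} K]
    (D : I ⥤ K) {θ : Cardinal.{w}} (A : DirectedSubset I θ) : HasColimit (restrict D A.1) :=
  have := A.2.1
  have := HasFilteredColimitsOfSize.HasColimitsOfShape (C := K) A.1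
  inferInstance

end DirectedSubset

end DirectedSubset

section Presentable

variable {K : Type u} [Category.{v} K]

lemma exists_directed_colimitsOfShape {P : ObjectProperty K} {lam : Cardinal.{w}}
    [Fact lam.IsRegular] (hP : P.IsCardinalFilteredGenerator lam) (X : K) :
    ∃ (I : Type w) (_ : PartialOrder I) (_ : IsCardinalFiltered I lam),
      P.colimitsOfShape I X := by
  obtain ⟨J, _, _, ⟨p⟩⟩ := hP.exists_colimitsOfShape X
  obtain ⟨I, _, _, F, _⟩ := IsCardinalFiltered.exists_cardinal_directed J lam
  exact ⟨I, inferInstance, inferInstance, ⟨p.reindex F⟩⟩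

lemma exists_section_partialDesc [HasFilteredColimitsOfSize.{w, w} K]
    {I : Type w} [PartialOrder I] [IsFiltered I] {D : I ⥤ K} {c : Cocone D} (hc : IsColimit c)
    {θ : Cardinal.{w}} [Fact θ.IsRegular] (hθ : Cardinal.aleph0 < θ)
    [IsCardinalPresentable c.pt θ] :
    ∃ (A : DirectedSubset I θ) (f : c.pt ⟶ (partialColimits D DirectedSubset.monotone_val).obj A),
      f ≫ partialDesc DirectedSubset.monotone_val c A = 𝟙 c.pt :=
  have := DirectedSubset.isCardinalFiltered (I := I) hθ
  have := DirectedSubset.isFiltered (I := I) hθ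
  have := IsFiltered.isDirectedOrder (DirectedSubset I θ)
  IsCardinalPresentable.exists_hom_of_isColimit θ
    (isColimitPartialCocone DirectedSubset.monotone_val (DirectedSubset.exists_mem hθ) hc)
    (𝟙 c.pt)

lemma hasCardinalLT_arrow_of_preorder {A : Type*} [Preorder A] {θ : Cardinal.{w}}
    (hθ : Cardinal.aleph0 ≤ θ) (hA : HasCardinalLT A θ) : HasCardinalLT (Arrow A) θ :=
  (hasCardinalLT_prod hθ hA hA).of_injective (fun f ↦ (f.left, f.right)) fun _ _ hfg ↦
    Arrow.ext (congr_arg Prod.fst hfg) (congr_arg Prod.snd hfg) (Subsingleton.elim _ _)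

lemma colimitsCardinalClosure_colimit_of_preorder (P : ObjectProperty K) {A : Type w} [Preorder A]
    {χ : Cardinal.{w}} (hχ : Cardinal.aleph0 ≤ χ) (hA : HasCardinalLT A χ) (D : A ⥤ K)
    [HasColimit D] (hD : ∀ i, P (D.obj i)) : P.colimitsCardinalClosure χ (colimit D) := by
  have := P.isClosedUnderColimitsOfShape_colimitsCardinalClosure χ A
    (hasCardinalLT_arrow_of_preorder hχ hA)
  exact ObjectProperty.prop_colimit _ D fun i ↦ P.le_colimitsCardinalClosure χ _ (hD i)

end Presentable

section Cardinality

lemma hasCardinalLT_of_isColimit {J : Type w} [SmallCategory J] {F : J ⥤ Type w} {c : Cocone F}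
    (hc : IsColimit c) {θ : Cardinal.{w}} [Fact θ.IsRegular] (hJ : HasCardinalLT J θ)
    (hF : ∀ j, HasCardinalLT (F.obj j) θ) : HasCardinalLT c.pt θ :=
  (hasCardinalLT_sigma (fun j ↦ F.obj j) θ hJ hF).of_surjective (fun x ↦ c.ι.app x.1 x.2) fun y ↦
    have ⟨j, x, hx⟩ := Types.jointly_surjective_of_isColimit hc y
    ⟨⟨j, x⟩, hx⟩

lemma exists_regular_hasCardinalLT_set (σ χ : Cardinal.{w}) :
    ∃ θ : Cardinal.{w}, θ.IsRegular ∧ σ < θ ∧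
      ∀ A : Type w, HasCardinalLT A θ → HasCardinalLT (HasCardinalLT.Set A χ) θ := by
  let τ := max (max σ χ) Cardinal.aleph0
  have hτ : Cardinal.aleph0 ≤ τ := le_max_right _ _
  have hτ' : τ < 2 ^ τ := Cardinal.cantor τ
  have hpow : ((2 : Cardinal.{w}) ^ τ) ^ τ = 2 ^ τ := by
    rw [← Cardinal.power_mul, Cardinal.mul_eq_self hτ]
  have hσ : σ ≤ τ := (le_max_left _ _).trans (le_max_left _ _)
  have hχ : χ ≤ τ := (le_max_right _ _).trans (le_max_left _ _)
  refine ⟨Order.succ (2 ^ τ), Cardinal.isRegular_succ (hτ.trans hτ'.le),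
    (hσ.trans_lt hτ').trans (Order.lt_succ _), fun A hA ↦ ?_⟩
  rw [hasCardinalLT_iff_cardinal_mk_lt, Order.lt_succ_iff] at hA ⊢
  have hinj : Function.Injective fun S : HasCardinalLT.Set A χ ↦
      (⟨S.1, ((hasCardinalLT_iff_cardinal_mk_lt _ _).1 S.2).le.trans hχ⟩ :
        { t : Set A // Cardinal.mk t ≤ τ }) :=
    fun _ _ hST ↦ Subtype.ext (congr_arg (·.1) hST)
  calc Cardinal.mk (HasCardinalLT.Set A χ)
    _ ≤ Cardinal.mk { t : Set A // Cardinal.mk t ≤ τ } := Cardinal.mk_le_of_injective hinj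
    _ ≤ max (Cardinal.mk A) Cardinal.aleph0 ^ τ := Cardinal.mk_bounded_set_le A τ
    _ ≤ (2 ^ τ) ^ τ := Cardinal.power_le_power_right (max_le hA (hτ.trans hτ'.le))
    _ = 2 ^ τ := hpow

variable {K : Type u} [Category.{v} K]

lemma exists_forall_hasCardinalLT_obj (U : K ⥤ Type w) (P : ObjectProperty K)
    [ObjectProperty.EssentiallySmall.{w} P] :
    ∃ σ : Cardinal.{w}, ∀ X, P X → HasCardinalLT (U.obj X) σ := by
  obtain ⟨Q, _, hQ⟩ := ObjectProperty.EssentiallySmall.exists_small_le'.{w} P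
  obtain ⟨σ, -, hσ⟩ := HasCardinalLT.exists_regular_cardinal_forall.{w}
    fun X : Subtype Q ↦ U.obj X.1
  refine ⟨σ, fun X hX ↦ ?_⟩
  obtain ⟨Y, hY, ⟨e⟩⟩ := hQ X hX
  exact (hasCardinalLT_iff_of_equiv (U.mapIso e).toEquiv _).2 (hσ ⟨Y, hY⟩)

/-- The colimit is the `χ`-directed colimit, preserved by `U`, of its partial colimits of size
less than `χ`. -/
lemma hasCardinalLT_obj_of_isColimit [HasFilteredColimitsOfSize.{w, w} K] (U : K ⥤ Type w)
    {χ θ : Cardinal.{w}} [Fact χ.IsRegular] [Fact θ.IsRegular] [U.IsCardinalAccessible χ]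
    (hχ : Cardinal.aleph0 < χ) {P : ObjectProperty K}
    (hP : ∀ X, P.colimitsCardinalClosure χ X → HasCardinalLT (U.obj X) θ)
    {A : Type w} [PartialOrder A] [IsFiltered A] (hA : HasCardinalLT (HasCardinalLT.Set A χ) θ)
    {D : A ⥤ K} (hD : ∀ i, P (D.obj i)) {c : Cocone D} (hc : IsColimit c) :
    HasCardinalLT (U.obj c.pt) θ := by
  have := DirectedSubset.isCardinalFiltered (I := A) hχ
  have := DirectedSubset.isFiltered (I := A) hχ
  have := IsFiltered.isDirectedOrder (DirectedSubset A χ)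
  have := U.preservesColimitsOfShape_of_isCardinalAccessible χ (DirectedSubset A χ)
  have hcol := isColimitPartialCocone DirectedSubset.monotone_val (DirectedSubset.exists_mem hχ) hc
  have hindex : HasCardinalLT (DirectedSubset A χ) θ :=
    hA.of_injective (fun B ↦ ⟨B.1, B.2.2⟩) fun _ _ hBC ↦ Subtype.ext (congr_arg (·.1) hBC)
  exact hasCardinalLT_of_isColimit (isColimitOfPreserves U hcol) hindex fun B ↦
    hP _ (colimitsCardinalClosure_colimit_of_preorder P hχ.le B.2.2 _ fun i ↦ hD i)

lemma exists_preservesPresentable [HasFilteredColimitsOfSize.{w, w} K] (U : K ⥤ Type w)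
    (κ : Cardinal.{w}) [Fact κ.IsRegular] [U.IsCardinalAccessible κ]
    (lam : Cardinal.{w}) [Fact lam.IsRegular] [IsCardinalAccessibleCategory K lam] :
    ∃ θ : Cardinal.{w}, lam ≤ θ ∧ ∃ _ : Fact θ.IsRegular, PreservesPresentable U θ := by
  let χ := Order.succ (max κ lam)
  have hκ : Cardinal.aleph0 ≤ max κ lam :=
    (Cardinal.IsRegular.aleph0_le Fact.out).trans (le_max_left _ _)
  have hχ : Cardinal.aleph0 < χ := hκ.trans_lt (Order.lt_succ _)
  have : Fact χ.IsRegular := ⟨Cardinal.isRegular_succ hκ⟩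
  have : U.IsCardinalAccessible χ :=
    U.isCardinalAccessible_of_le ((le_max_left κ lam).trans (Order.le_succ _))
  obtain ⟨σ, hσ⟩ := exists_forall_hasCardinalLT_obj U
    ((isCardinalPresentable K lam).colimitsCardinalClosure χ)
  obtain ⟨θ, hreg, hlt, hθ⟩ := exists_regular_hasCardinalLT_set (max σ χ) χ
  have hχθ : χ < θ := (le_max_right _ _).trans_lt hlt
  have : Fact θ.IsRegular := ⟨hreg⟩
  refine ⟨θ, ((le_max_right κ lam).trans (Order.le_succ _)).trans hχθ.le, this, fun X _ ↦ ?_⟩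
  obtain ⟨I, _, _, ⟨p⟩⟩ := exists_directed_colimitsOfShape
    (isCardinalFilteredGenerator_isCardinalPresentable K lam) X
  have := isFiltered_of_isCardinalFiltered I lam
  obtain ⟨A, f, hf⟩ := exists_section_partialDesc p.isColimit (hχ.trans hχθ)
  have := A.2.1
  have hA : HasCardinalLT (U.obj (colimit (restrict p.diag A.1))) θ :=
    hasCardinalLT_obj_of_isColimit U hχ
      (fun Y hY ↦ (hσ Y hY).of_le ((le_max_left _ _).trans hlt.le)) (hθ _ A.2.2)
      (fun i ↦ p.prop_diag_obj i) (colimit.isColimit (restrict p.diag A.1))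
  have : IsSplitMono f := .mk' ⟨_, hf⟩
  exact (Types.isCardinalPresentable_iff _).2
    (hA.of_injective (U.map f) ((mono_iff_injective _).1 inferInstance))

lemma lambdaU_spec [HasFilteredColimitsOfSize.{w, w} K] (U : K ⥤ Type w)
    (κ : Cardinal.{w}) [Fact κ.IsRegular] [U.IsCardinalAccessible κ]
    (lam : Cardinal.{w}) [Fact lam.IsRegular] [IsCardinalAccessibleCategory K lam] :
    lam ≤ lambdaU U lam ∧
      ∃ _ : Fact (lambdaU U lam).IsRegular, PreservesPresentable U (lambdaU U lam) :=
  csInf_mem (exists_preservesPresentable U κ lam)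

lemma hasCardinalLT_obj_of_lambdaU_le [HasFilteredColimitsOfSize.{w, w} K] (U : K ⥤ Type w)
    (κ : Cardinal.{w}) [Fact κ.IsRegular] [U.IsCardinalAccessible κ]
    (lam : Cardinal.{w}) [Fact lam.IsRegular] [IsCardinalAccessibleCategory K lam]
    {μ : Cardinal.{w}} (hμ : lambdaU U lam ≤ μ) {X : K} [IsCardinalPresentable X lam] :
    HasCardinalLT (U.obj X) μ := by
  obtain ⟨hlam, _, hU⟩ := lambdaU_spec U κ lam
  exact ((Types.isCardinalPresentable_iff _).1 (hU (isCardinalPresentable_of_le X hlam))).of_le hμ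

end Cardinality

section StrongEpiFamily

variable {K : Type u} [Category.{v} K]

/-- A family of morphisms `x i : G i ⟶ N` is strongly epimorphic if a morphism `k : N ⟶ C` factors
through a monomorphism `g : B ⟶ C` as soon as all the `x i ≫ k` do. -/
def IsStrongEpiFamily {ι : Type*} {G : ι → K} {N : K} (x : ∀ i, G i ⟶ N) : Prop :=
  ∀ ⦃B C : K⦄ (g : B ⟶ C) [Mono g] (k : N ⟶ C),
    (∀ i, ∃ t : G i ⟶ B, t ≫ g = x i ≫ k) → ∃ t : N ⟶ B, t ≫ g = k

lemma isStrongEpiFamily_of_isColimit {J : Type*} [Category* J] {D : J ⥤ K} {c : Cocone D}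
    (hc : IsColimit c) : IsStrongEpiFamily fun j ↦ c.ι.app j := by
  intro B C g _ k hk
  choose t ht using hk
  let s : Cocone D :=
    { pt := B
      ι :=
        { app := t
          naturality i j f := by
            rw [← cancel_mono g, Category.assoc, ht, ← Category.assoc, c.w]
            exact (ht i).symm.trans (congr_arg (· ≫ g) (Category.comp_id _).symm) } }
  exact ⟨hc.desc s, hc.hom_ext fun j ↦
    (Category.assoc _ _ _).symm.trans ((congr_arg (· ≫ g) (hc.fac s j)).trans (ht j))⟩

lemma IsStrongEpiFamily.comp_of_section {ι : Type*} {G : ι → K} {N N' : K} {x : ∀ i, G i ⟶ N}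
    (hx : IsStrongEpiFamily x) {e : N ⟶ N'} {f : N' ⟶ N} (hfe : f ≫ e = 𝟙 N') :
    IsStrongEpiFamily fun i ↦ x i ≫ e := by
  intro B C g _ k hk
  obtain ⟨t, ht⟩ := hx g (e ≫ k) fun i ↦ by simpa only [Category.assoc] using hk i
  exact ⟨f ≫ t, by rw [Category.assoc, ht, ← Category.assoc, hfe, Category.id_comp]⟩

lemma exists_isStrongEpiFamily [HasFilteredColimitsOfSize.{w, w} K] {P : ObjectProperty K}
    {lam : Cardinal.{w}} [Fact lam.IsRegular] (hP : P.IsCardinalFilteredGenerator lam)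
    {θ : Cardinal.{w}} [Fact θ.IsRegular] (hθ : Cardinal.aleph0 < θ)
    (N : K) [IsCardinalPresentable N θ] :
    ∃ (ι : Type w) (G : ι → K) (x : ∀ i, G i ⟶ N),
      HasCardinalLT ι θ ∧ (∀ i, P (G i)) ∧ IsStrongEpiFamily x := by
  obtain ⟨I, _, _, ⟨p⟩⟩ := exists_directed_colimitsOfShape hP N
  have := isFiltered_of_isCardinalFiltered I lam
  obtain ⟨A, f, hf⟩ := exists_section_partialDesc p.isColimit hθ
  exact ⟨A.1, fun i ↦ p.diag.obj i.1, _, A.2.2, fun i ↦ p.prop_diag_obj i.1,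
    (isStrongEpiFamily_of_isColimit (colimit.isColimit (restrict p.diag A.1))).comp_of_section hf⟩

end StrongEpiFamily

section PartialExtension

variable {K : Type u} [Category.{v} K] {U : K ⥤ Type w}

lemma exists_amalgam_of_realizesAllTypes (hAP : HasAmalgamation K) {A B X : K} {r : A ⟶ B}
    (hr : realizesAllTypes U r) (f : A ⟶ X) (a : Option (U.obj X)) :
    ∃ (P : K) (g : X ⟶ P) (φ : B ⟶ P), f ≫ g = r ≫ φ ∧ ∀ x ∈ a, ∃ y, U.map φ y = U.map g x := by
  obtain _ | x := a
  · obtain ⟨P, g, φ, hP⟩ := hAP f r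
    exact ⟨P, g, φ, hP, by simp⟩
  · obtain ⟨y, P, g, φ, hP, hy⟩ := hr f x
    refine ⟨P, g, φ, hP, fun x' hx' ↦ ⟨y, ?_⟩⟩
    obtain rfl := Option.mem_some_iff.1 hx'
    exact hy.symm

variable {J : Type w} [LinearOrder J] [OrderBot J] [SuccOrder J]
  (F : J ⥤ K) {N : K} (h : F.obj ⊥ ⟶ N) (a : J → Option (U.obj N))

/-- An extension of `N` together with a compatible embedding, over `h`, of an initial segment of
the chain `F`, such that the image of the `i + 1`-st stage of the chain contains the element
`a i` of `N` (if any). -/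
structure PartialExtension where
  obj : K
  base : N ⟶ obj
  /-- the indices of the stages of the chain which are embedded in the extension -/
  dom : LowerSet J
  map (j : J) (hj : j ∈ dom) : F.obj j ⟶ obj
  w {i j : J} (hij : i ≤ j) (hj : j ∈ dom) :
    F.map (homOfLE hij) ≫ map j hj = map i (dom.lower hij hj)
  bot_mem : ⊥ ∈ dom
  map_bot : map ⊥ bot_mem = h ≫ base
  realizes (i : J) (hi : Order.succ i ∈ dom) : ∀ x ∈ a i,
    ∃ y, U.map (map (Order.succ i) hi) y = U.map base x

namespace PartialExtension

variable {F h a}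

/-- Morphisms of partial extensions: morphisms of extensions of `N` which are compatible with the
embeddings of the stages of the chain, and may embed further stages. -/
@[ext]
structure Hom (X Y : PartialExtension F h a) where
  hom : X.obj ⟶ Y.obj
  base_hom : X.base ≫ hom = Y.base
  dom_le : X.dom ≤ Y.dom
  map_hom (j : J) (hj : j ∈ X.dom) : X.map j hj ≫ hom = Y.map j (dom_le hj)

instance : Category (PartialExtension F h a) where
  Hom := Hom
  id X := ⟨𝟙 _, by simp, le_rfl, by simp⟩
  comp f g := ⟨f.hom ≫ g.hom, by rw [← Category.assoc, f.base_hom, g.base_hom],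
    f.dom_le.trans g.dom_le,
    fun j hj ↦ by rw [← Category.assoc, f.map_hom, g.map_hom]⟩

lemma hom_ext {X Y : PartialExtension F h a} {f g : X ⟶ Y} (hfg : f.hom = g.hom) : f = g :=
  Hom.ext hfg

variable (F h a) in
/-- The functor sending a partial extension to the underlying extension of `N`. -/
def forget : PartialExtension F h a ⥤ K where
  obj X := X.obj
  map f := f.hom

section Colimits

variable {T : Type w} [SmallCategory T] {G : T ⥤ PartialExtension F h a}

/-- The components of a cocone on the underlying diagram of a diagram of partial extensions, with
their source written as the object of a partial extension for the sake of rewriting. -/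
def forgetι (c : Cocone (G ⋙ forget F h a)) (t : T) : (G.obj t).obj ⟶ c.pt := c.ι.app t

lemma hom_forgetι (c : Cocone (G ⋙ forget F h a)) {t t' : T} (f : t ⟶ t') :
    (G.map f).hom ≫ forgetι c t' = forgetι c t :=
  c.w f

lemma forgetι_desc {c : Cocone (G ⋙ forget F h a)} (hc : IsColimit c) (s : Cocone G) (t : T) :
    forgetι c t ≫ hc.desc ((forget F h a).mapCocone s) = (s.ι.app t).hom :=
  hc.fac _ t

variable [IsFiltered T]

lemma base_forgetι (c : Cocone (G ⋙ forget F h a)) (t t' : T) :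
    (G.obj t).base ≫ forgetι c t = (G.obj t').base ≫ forgetι c t' := by
  rw [← hom_forgetι c (IsFiltered.leftToMax t t'), ← hom_forgetι c (IsFiltered.rightToMax t t'),
    ← Category.assoc, ← Category.assoc, Hom.base_hom, Hom.base_hom]

lemma map_forgetι (c : Cocone (G ⋙ forget F h a)) (t t' : T) {j : J}
    (ht : j ∈ (G.obj t).dom) (ht' : j ∈ (G.obj t').dom) :
    (G.obj t).map j ht ≫ forgetι c t = (G.obj t').map j ht' ≫ forgetι c t' := by
  rw [← hom_forgetι c (IsFiltered.leftToMax t t'), ← hom_forgetι c (IsFiltered.rightToMax t t'),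
    ← Category.assoc, ← Category.assoc, Hom.map_hom, Hom.map_hom]

/-- The partial extension supported by the vertex of a cocone on the underlying diagram, in which
a stage of the chain is embedded if it is so in some member of the diagram. -/
noncomputable def liftedPt (c : Cocone (G ⋙ forget F h a)) : PartialExtension F h a where
  obj := c.pt
  base := (G.obj (IsFiltered.nonempty (C := T)).some).base ≫ forgetι c _
  dom := ⨆ t, (G.obj t).dom
  map j hj := (G.obj (LowerSet.mem_iSup_iff.1 hj).choose).map j
    (LowerSet.mem_iSup_iff.1 hj).choose_spec ≫ forgetι c _
  w {i j} hij hj := by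
    rw [← Category.assoc, (G.obj _).w]
    apply map_forgetι
  bot_mem := LowerSet.mem_iSup_iff.2 ⟨(IsFiltered.nonempty (C := T)).some, (G.obj _).bot_mem⟩
  map_bot := by
    rw [map_forgetι c _ (IsFiltered.nonempty (C := T)).some _ (G.obj _).bot_mem,
      (G.obj _).map_bot, Category.assoc]
  realizes i hi x hx := by
    obtain ⟨y, hy⟩ := (G.obj (LowerSet.mem_iSup_iff.1 hi).choose).realizes i
      (LowerSet.mem_iSup_iff.1 hi).choose_spec x hx
    refine ⟨y, ?_⟩
    rw [base_forgetι c _ (LowerSet.mem_iSup_iff.1 hi).choose, U.map_comp, U.map_comp]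
    exact congr_arg (U.map (forgetι c _)) hy

/-- The lift to partial extensions of a cocone on the underlying diagram. -/
noncomputable def liftedCocone (c : Cocone (G ⋙ forget F h a)) : Cocone G where
  pt := liftedPt c
  ι :=
    { app t :=
        { hom := forgetι c t
          base_hom := base_forgetι c _ _
          dom_le := le_iSup (fun t ↦ (G.obj t).dom) t
          map_hom _ _ := map_forgetι c _ _ _ _ }
      naturality _ _ f := hom_ext (c.ι.naturality f) }

/-- The morphism from the lift of a colimit cocone induced by a cocone of partial extensions. -/
noncomputable def liftedDesc {c : Cocone (G ⋙ forget F h a)} (hc : IsColimit c) (s : Cocone G) :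
    liftedPt c ⟶ s.pt where
  hom := hc.desc ((forget F h a).mapCocone s)
  base_hom := (Category.assoc _ _ _).trans
    ((congr_arg (_ ≫ ·) (forgetι_desc hc s _)).trans (s.ι.app _).base_hom)
  dom_le := iSup_le fun t ↦ (s.ι.app t).dom_le
  map_hom j _ := (Category.assoc _ _ _).trans
    ((congr_arg (_ ≫ ·) (forgetι_desc hc s _)).trans ((s.ι.app _).map_hom j _))

/-- The functor `forget` creates filtered colimits. -/
noncomputable def isColimitLiftedCocone {c : Cocone (G ⋙ forget F h a)} (hc : IsColimit c) :
    IsColimit (liftedCocone c) where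
  desc := liftedDesc hc
  fac s t := hom_ext (forgetι_desc hc s t)
  uniq s m hm := hom_ext (hc.uniq ((forget F h a).mapCocone s) m.hom
    fun t ↦ congr_arg Hom.hom (hm t))

end Colimits

lemma hasColimitsOfShape [HasFilteredColimitsOfSize.{w, w} K] (T : Type w) [SmallCategory T]
    [IsFiltered T] : HasColimitsOfShape T (PartialExtension F h a) where
  has_colimit _ :=
    have := HasFilteredColimitsOfSize.HasColimitsOfShape (C := K) T
    ⟨⟨_, isColimitLiftedCocone (colimit.isColimit _)⟩⟩

variable (F h a) in
lemma hasIterationOfShape [HasFilteredColimitsOfSize.{w, w} K] :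
    HasIterationOfShape J (PartialExtension F h a) where
  hasColimitsOfShape_of_isSuccLimit j hj := by
    have : Nonempty (Set.Iio j) := ⟨⊥, hj.bot_lt⟩
    exact hasColimitsOfShape _
  hasColimitsOfShape := hasColimitsOfShape _

variable (F h a) in
/-- The partial extension given by `N`, in which only the first stage of the chain is embedded. -/
def initial [NoMaxOrder J] : PartialExtension F h a where
  obj := N
  base := 𝟙 N
  dom := LowerSet.Iic ⊥
  map j hj := F.map (homOfLE hj) ≫ h
  w hij hj := by rw [← Category.assoc, ← F.map_comp]; rfl
  bot_mem := le_rfl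
  map_bot := by simp
  realizes i hi := ((Order.bot_lt_succ i).not_ge hi).elim

/-- An embedding of the `j`-th stage of the chain in a further extension of the object underlying
the partial extension `X`, as required for `j` to be added to the domain of `X`. -/
structure StageEmbedding (X : PartialExtension F h a) (j : J) where
  obj : K
  hom : X.obj ⟶ obj
  map : F.obj j ⟶ obj
  w {i : J} (hi : i ∈ X.dom) (hij : i < j) : F.map (homOfLE hij.le) ≫ map = X.map i hi ≫ hom
  realizes (i : J) (hi : Order.succ i = j) : ∀ x ∈ a i,
    ∃ y, U.map map y = U.map hom (U.map X.base x)

namespace StageEmbedding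

variable {X : PartialExtension F h a} {j : J}

/-- The partial extension obtained by adding one more stage of the chain. -/
def extend (E : StageEmbedding X j) (hj : X.dom = LowerSet.Iio j) : PartialExtension F h a :=
  have hX {i : J} : i ∈ X.dom ↔ i < j := by rw [hj, LowerSet.mem_Iio_iff]
  { obj := E.obj
    base := X.base ≫ E.hom
    dom := LowerSet.Iic j
    map i hi := F.map (homOfLE hi) ≫ E.map
    w hij hj := by rw [← Category.assoc, ← F.map_comp]; rfl
    bot_mem := bot_le
    map_bot := by rw [E.w X.bot_mem (hX.1 X.bot_mem), X.map_bot, Category.assoc]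
    realizes i hi x hx := by
      obtain hij | rfl := lt_or_eq_of_le (show Order.succ i ≤ j from hi)
      · obtain ⟨y, hy⟩ := X.realizes i (hX.2 hij) x hx
        refine ⟨y, ?_⟩
        rw [E.w (hX.2 hij) hij, U.map_comp, U.map_comp]
        exact congr_arg (U.map E.hom) hy
      · obtain ⟨y, hy⟩ := E.realizes i rfl x hx
        refine ⟨y, ?_⟩
        rw [show homOfLE hi = 𝟙 _ from rfl, F.map_id, Category.id_comp, U.map_comp]
        exact hy }

/-- The morphism to the partial extension obtained by adding one more stage of the chain. -/
def toExtend (E : StageEmbedding X j) (hj : X.dom = LowerSet.Iio j) : X ⟶ E.extend hj where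
  hom := E.hom
  base_hom := rfl
  dom_le := hj.trans_le fun _ hi ↦ le_of_lt hi
  map_hom i hi := (E.w hi (by rwa [hj] at hi)).symm

end StageEmbedding

lemma nonempty_stageEmbedding_succ [NoMaxOrder J] (hAP : HasAmalgamation K)
    {X : PartialExtension F h a} {i : J}
    (hF : realizesAllTypes U (F.map (homOfLE (Order.le_succ i)))) (hi : i ∈ X.dom) :
    Nonempty (StageEmbedding X (Order.succ i)) := by
  obtain ⟨P, g, φ, hgφ, hφ⟩ :=
    exists_amalgam_of_realizesAllTypes hAP hF (X.map i hi) ((a i).map (U.map X.base))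
  refine ⟨P, g, φ, fun {k} hk hki ↦ ?_, fun k hk x hx ↦ ?_⟩
  · rw [← X.w (Order.lt_succ_iff.1 hki) hi, Category.assoc, hgφ, ← Category.assoc, ← F.map_comp]
    rfl
  · obtain rfl := Order.succ_injective hk
    exact hφ _ (Option.mem_map_of_mem _ hx)

lemma nonempty_stageEmbedding_of_isSuccLimit [NoMaxOrder J] [F.IsWellOrderContinuous]
    {X : PartialExtension F h a} {j : J} (hj : Order.IsSuccLimit j)
    (hX : ∀ i < j, i ∈ X.dom) : Nonempty (StageEmbedding X j) := by
  let s : Cocone ((Set.principalSegIio j).monotone.functor ⋙ F) :=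
    { pt := X.obj
      ι :=
        { app i := X.map i.1 (hX _ i.2)
          naturality i i' f :=
            (X.w (leOfHom f) (hX _ i'.2)).trans (Category.comp_id _).symm } }
  let hc := F.isColimitOfIsWellOrderContinuous j hj
  exact ⟨X.obj, 𝟙 _, hc.desc s,
    fun _ hi ↦ (hc.fac s ⟨_, hi⟩).trans (Category.comp_id _).symm,
    fun i hi ↦ (hj.succ_ne i hi).elim⟩

variable [WellFoundedLT J] [NoMaxOrder J] [F.IsWellOrderContinuous]

lemma nonempty_stageEmbedding (hAP : HasAmalgamation K)
    (hF : ∀ j, realizesAllTypes U (F.map (homOfLE (Order.le_succ j))))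
    {X : PartialExtension F h a} {j : J} (hj : X.dom = LowerSet.Iio j) :
    Nonempty (StageEmbedding X j) := by
  have hX (i : J) (hi : i < j) : i ∈ X.dom := by rwa [hj]
  induction j using SuccOrder.limitRecOn with
  | isMin j hmin =>
    have hbot : ⊥ < j := by simpa only [hj, LowerSet.mem_Iio_iff] using X.bot_mem
    exact (hmin.not_lt hbot).elim
  | succ i _ _ => exact nonempty_stageEmbedding_succ hAP (hF i) (hX i (Order.lt_succ i))
  | isSuccLimit j hlim _ => exact nonempty_stageEmbedding_of_isSuccLimit hlim hX

lemma exists_hom_forall_mem_dom (hAP : HasAmalgamation K)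
    (hF : ∀ j, realizesAllTypes U (F.map (homOfLE (Order.le_succ j))))
    (X : PartialExtension F h a) :
    ∃ (Y : PartialExtension F h a) (_ : X ⟶ Y), ∀ j, (∀ i < j, i ∈ X.dom) → j ∈ Y.dom := by
  obtain hX | ⟨j, hj⟩ := X.dom.lower.eq_univ_or_Iio
  · exact ⟨X, 𝟙 X, fun j _ ↦ hX.symm.subset (Set.mem_univ j)⟩
  · obtain ⟨E⟩ := nonempty_stageEmbedding hAP hF (SetLike.coe_injective hj)
    refine ⟨_, E.toExtend (SetLike.coe_injective hj), fun k hk ↦ le_of_not_gt fun hjk ↦ ?_⟩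
    exact lt_irrefl j (hj.subset (hk j hjk))

variable (h a) in
lemma exists_forall_mem_dom [HasFilteredColimitsOfSize.{w, w} K] (hAP : HasAmalgamation K)
    (hF : ∀ j, realizesAllTypes U (F.map (homOfLE (Order.le_succ j)))) :
    ∃ X : PartialExtension F h a, ∀ j, j ∈ X.dom := by
  choose succ toSucc hsucc using exists_hom_forall_mem_dom (h := h) (a := a) hAP hF
  let Φ : SmallObject.SuccStruct (PartialExtension F h a) :=
    { X₀ := initial F h a
      succ := succ
      toSucc := toSucc }
  have := hasIterationOfShape F h a
  let X := Φ.iterationFunctor J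
  have hX (j : J) : j ∈ (X.obj (Order.succ j)).dom := by
    induction j using WellFoundedLT.induction with
    | ind j hj =>
      refine (Φ.iterationFunctorObjSuccIso j (not_isMax j)).inv.dom_le (hsucc _ j fun i hi ↦ ?_)
      exact (X.map (homOfLE (Order.succ_le_of_lt hi))).dom_le (hj i hi)
  exact ⟨Φ.iteration J, fun j ↦ ((Φ.iterationCocone J).ι.app (Order.succ j)).dom_le (hX j)⟩

end PartialExtension

end PartialExtension

section Universal

variable {K : Type u} [Category.{v} K] {U : K ⥤ Type w}

lemma IsCoherent.exists_factorization [U.Faithful] (hU : IsCoherent U) {A B C : K}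
    (h : A ⟶ C) (g : B ⟶ C) (hg : ∀ x : U.obj A, ∃ y : U.obj B, U.map g y = U.map h x) :
    ∃ t : A ⟶ B, t ≫ g = h := by
  choose φ hφ using hg
  have hcomp : (↾φ : U.obj A ⟶ U.obj B) ≫ U.map g = U.map h := by
    ext x
    exact hφ x
  obtain ⟨t, ht⟩ := hU h g (↾φ) hcomp
  exact ⟨t, U.map_injective (by rw [U.map_comp, ht, hcomp])⟩

lemma exists_amalgam_of_transfiniteComposition [HasFilteredColimitsOfSize.{w, w} K]
    (hAP : HasAmalgamation K) {J : Type w} [LinearOrder J] [OrderBot J] [SuccOrder J]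
    [WellFoundedLT J] [NoMaxOrder J] {M M' N : K} {m : M ⟶ M'}
    (c : (realizesAllTypes U).TransfiniteCompositionOfShape J m)
    (h : M ⟶ N) (a : J → Option (U.obj N)) :
    ∃ (P : K) (g : M' ⟶ P) (k : N ⟶ P), m ≫ g = h ≫ k ∧
      ∀ j, ∀ x ∈ a j, ∃ y, U.map g y = U.map k x := by
  obtain ⟨X, hX⟩ := PartialExtension.exists_forall_mem_dom (F := c.F)
    (c.isoBot.hom ≫ h) a hAP fun j ↦ c.map_mem j (not_isMax j)
  let s : Cocone c.F :=
    { pt := X.obj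
      ι :=
        { app j := X.map j (hX j)
          naturality i j f := (X.w (leOfHom f) (hX j)).trans (Category.comp_id _).symm } }
  have hs (j : J) : c.incl.app j ≫ c.isColimit.desc s = X.map j (hX j) := c.isColimit.fac s j
  refine ⟨X.obj, c.isColimit.desc s, X.base, ?_, fun j x hx ↦ ?_⟩
  · calc m ≫ c.isColimit.desc s
      _ = c.isoBot.inv ≫ c.incl.app ⊥ ≫ c.isColimit.desc s :=
          (congr_arg (· ≫ c.isColimit.desc s) c.fac.symm).trans (Category.assoc _ _ _)
      _ = c.isoBot.inv ≫ (c.isoBot.hom ≫ h) ≫ X.base :=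
          congr_arg (c.isoBot.inv ≫ ·) ((hs ⊥).trans X.map_bot)
      _ = h ≫ X.base := by simp
  · obtain ⟨y, hy⟩ := X.realizes j (hX _) x hx
    refine ⟨U.map (c.incl.app (Order.succ j)) y, ?_⟩
    rw [← hy, ← hs]
    exact (Functor.map_comp_apply U (c.incl.app (Order.succ j)) (c.isColimit.desc s) y).symm

lemma exists_enumeration {E : Type w} {X : Type*} {μ : Cardinal.{w}} (hE : Cardinal.mk E ≤ μ)
    (f : E → X) : ∃ a : μ.ord.ToType → Option X, ∀ x, ∃ j, f x ∈ a j := by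
  rw [← Cardinal.mk_ord_toType μ] at hE
  obtain ⟨e⟩ := hE
  exact ⟨fun j ↦ (Function.partialInv e j).map f, fun x ↦
    ⟨e x, by simp [Function.partialInv_left e.injective]⟩⟩

lemma IsOneSpecial.exists_amalgam [HasFilteredColimitsOfSize.{w, w} K] (hAP : HasAmalgamation K)
    {μ : Cardinal.{w}} (hμ : Cardinal.aleph0 ≤ μ) {M M' N : K} {m : M ⟶ M'}
    (hm : IsOneSpecial U μ m) (h : M ⟶ N) {E : Type w} (hE : Cardinal.mk E ≤ μ)
    (f : E → U.obj N) :
    ∃ (P : K) (g : M' ⟶ P) (k : N ⟶ P), m ≫ g = h ≫ k ∧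
      ∀ e, ∃ y, U.map g y = U.map k (f e) := by
  obtain ⟨_, ⟨c⟩⟩ := hm
  have : NoMaxOrder μ.ord.ToType := Cardinal.noMaxOrder hμ
  obtain ⟨a, ha⟩ := exists_enumeration hE f
  obtain ⟨P, g, k, hgk, hk⟩ := exists_amalgam_of_transfiniteComposition hAP c h a
  exact ⟨P, g, k, hgk, fun e ↦ have ⟨j, hj⟩ := ha e; hk j _ hj⟩

lemma aleph0_le_of_isRegular_succ {μ : Cardinal.{w}} (hμ : (Order.succ μ).IsRegular) :
    Cardinal.aleph0 ≤ μ :=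
  not_lt.1 fun h ↦ hμ.aleph0_le.not_gt (Cardinal.isSuccLimit_aleph0.succ_lt h)

end Universal

end WeakCAEC

open WeakCAEC in
theorem mainTheorem3_general {K : Type u} [Category.{v} K] [HasFilteredColimitsOfSize.{w, w} K]
    (U : K ⥤ Type w) [U.Faithful] (hmono : ∀ ⦃A B : K⦄ (f : A ⟶ B), Mono f)
    (hcoh : IsCoherent U) (hAP : HasAmalgamation K)
    (lam : Cardinal.{w}) [Fact lam.IsRegular] [IsCardinalAccessibleCategory K lam]
    (μ : Cardinal.{w}) [hμ : Fact (Order.succ μ).IsRegular]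
    (hU : ∀ X : K, IsCardinalPresentable X lam → HasCardinalLT (U.obj X) (Order.succ μ))
    {M M' : K} (m : M ⟶ M') (hm : IsOneSpecial U μ m)
    {N : K} (h : M ⟶ N) (hN : HasSizeLE N μ) :
    ∃ t : N ⟶ M', h ≫ t = m := by
  have hμ₀ : Cardinal.aleph0 ≤ μ := aleph0_le_of_isRegular_succ hμ.out
  have : IsCardinalPresentable N (Order.succ μ) := hN
  obtain ⟨ι, G, x, hι, hG, hx⟩ := exists_isStrongEpiFamily
    (isCardinalFilteredGenerator_isCardinalPresentable K lam) (hμ₀.trans_lt (Order.lt_succ μ)) N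
  have hE : Cardinal.mk (Σ i, U.obj (G i)) ≤ μ :=
    Order.lt_succ_iff.1 <| (hasCardinalLT_iff_cardinal_mk_lt _ _).1 <|
      hasCardinalLT_sigma (fun i ↦ U.obj (G i)) _ hι fun i ↦ hU _ (hG i)
  obtain ⟨P, g, k, hgk, hk⟩ := hm.exists_amalgam hAP hμ₀ h hE fun e ↦ U.map (x e.1) e.2
  have := hmono g
  have hfac (i : ι) : ∃ t : G i ⟶ M', t ≫ g = x i ≫ k :=
    hcoh.exists_factorization _ _ fun z ↦ by simpa using hk ⟨i, z⟩
  obtain ⟨t, ht⟩ := hx g k hfac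
  exact ⟨t, by rw [← cancel_mono g, Category.assoc, ht, hgk]⟩

/-- In a weak `κ`-CAEC with amalgamation, `lam`-accessible as a category, 1-special extensions
of size `μ` are universal, when `μ⁺` is sharply greater than `κ` and `μ ≥ λ_U`. (The regularity
of `μ⁺` just says that `μ` is infinite.) -/
theorem mainTheorem3 {K : Type u} [Category.{v} K] (U : K ⥤ Type w)
    (κ : Cardinal.{w}) [Fact κ.IsRegular] (hK : WeakCAEC.IsWeakCAEC U κ)
    (hAP : WeakCAEC.HasAmalgamation K)
    (lam : Cardinal.{w}) [Fact lam.IsRegular] [IsCardinalAccessibleCategory K lam]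
    (μ : Cardinal.{w}) [Fact (Order.succ μ).IsRegular]
    (hκμ : Cardinal.SharplyLT κ (Order.succ μ)) (hμ : WeakCAEC.lambdaU U lam ≤ μ)
    {M M' : K} (m : M ⟶ M') (hM : WeakCAEC.HasSize M μ) (hM' : WeakCAEC.HasSize M' μ)
    (hm : WeakCAEC.IsOneSpecial U μ m) :
    WeakCAEC.IsUniversalOver μ m := by
  have := hK.faithful
  have := hK.hasDirectedColimits
  have := hK.preservesDirectedColimits
  exact fun N h _ hN ↦ mainTheorem3_general U hK.mono hK.coherent hAP lam μ
    (fun _ _ ↦ (WeakCAEC.hasCardinalLT_obj_of_lambdaU_le U κ lam hμ).of_le (Order.le_succ μ))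
    m hm h hN
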